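/- Let $n\ge 0$ be an integer, let $[n]=\{1,\dots,n\}$, and let $2^{[n]}$ be the family of all subsets of $[n]$. For a real number $p\in(0,1)$ and a family $\mathcal F\subset 2^{[n]}$ put \[ \mu_p(\mathcal F)=\sum_{F\in\mathcal F}p^{|F|}(1-p)^{n-|F|}. \] Let $0<p\le \frac13$, and suppose that two families $\mathcal F,\mathcal G\subset 2^{[n]}$ are cross $2$-intersecting, that is, $|F\cap G|\ge 2$ for all $F\in\mathcal F$ and $G\in\mathcal G$. Then \[ \mu_p(\mathcal F)\,\mu_p(\mathcal G)\le p^4 . \] Moreover, if $p<\frac13$ and $\mu_p(\mathcal F)\,\mu_p(\mathcal G)=p^4$, then there is a $2$-element subset $T\subset[n]$ such that \[ \mathcal F=\mathcal G=\{F\in 2^{[n]}: T\subset F\}. \] -/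

import Mathlib

/-- Two families `F`, `G` of subsets of `[n]` (modelled by `Fin n`) are cross `t`-intersecting if
`|A ∩ B| ≥ t` for all `A ∈ F` and `B ∈ G`. -/
def CrossIntersecting {n : ℕ} (t : ℕ) (F G : Finset (Finset (Fin n))) : Prop :=
  ∀ A ∈ F, ∀ B ∈ G, t ≤ (A ∩ B).card

/-- The `p`-biased measure `μ_p(F) = ∑_{A ∈ F} p^|A| (1-p)^(n-|A|)` of a family `F` of subsets
of `[n]`. The truncated subtraction is harmless, since `|A| ≤ n`. -/
noncomputable def biasedMeasure {n : ℕ} (p : ℝ) (F : Finset (Finset (Fin n))) : ℝ :=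
  ∑ A ∈ F, p ^ A.card * (1 - p) ^ (n - A.card)

/-! For `p < 1/3` the proof is by induction on the size `s` of the ground set `S`, applied to a pair
`F`, `G` of maximal measure product. Fix `m ∈ S`. Shifting from `m` to the other points makes both
families stable without changing measures or cross-intersection. If no member loses membership when
`m` is deleted, neither family depends on `m`, and `m` can be dropped from `S` (`mu_eq_mu_erase`).

Otherwise, delete `m` from the boundary sets of `F` of size `a` and discard the boundary sets of `G`
of size `b = s + 2 - a`. The new pair is still cross 2-intersecting (`Cross.exchange`), so
maximality bounds its product. This inequality and its mirror image put more than half of each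
measure on one boundary level (`dominant_of_exchange`), so the boundary of `F` lies on level `a` and
that of `G` on level `b`.

Hence little measure is left for sets avoiding `m`. Stability, however, creates many such sets by
replacing `m` with another point. Double counting turns this tension into `3(s - a) < 2a` and `3(s -
b) < 2b`, which leaves finitely many triples `(s, a, b)`. In each of them all members of `F` have
size at least `a` and all members of `G` size at least `b`, and binomial tails give the bound.

In the equality case both families contain a 2-set, which forces a star. The value `p = 1/3` follows
by continuity. -/

namespace CrossTwo

variable {V : Type*}

/-- The `p`-biased weight of a subset `A` of `S`. -/
noncomputable def wt (S : Finset V) (p : ℝ) (A : Finset V) : ℝ :=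
  p ^ A.card * (1 - p) ^ (S.card - A.card)

/-- The `p`-biased measure of a family of subsets of `S`. -/
noncomputable def mu (S : Finset V) (p : ℝ) (F : Finset (Finset V)) : ℝ :=
  ∑ A ∈ F, wt S p A

/-! ### Biased weights and binomial tails. -/

section weights

variable {S : Finset V} {p : ℝ}

theorem wt_pos (hp0 : 0 < p) (hp1 : p < 1) (A : Finset V) : 0 < wt S p A := by
  have : 0 < 1 - p := by linarith
  unfold wt
  positivity

theorem mu_nonneg (hp0 : 0 < p) (hp1 : p < 1) (F : Finset (Finset V)) : 0 ≤ mu S p F :=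
  Finset.sum_nonneg fun A _ => (wt_pos hp0 hp1 A).le

theorem mu_mono (hp0 : 0 < p) (hp1 : p < 1) {F G : Finset (Finset V)} (h : F ⊆ G) :
    mu S p F ≤ mu S p G :=
  Finset.sum_le_sum_of_subset_of_nonneg h fun A _ _ => (wt_pos hp0 hp1 A).le

theorem mu_pos_of_nonempty (hp0 : 0 < p) (hp1 : p < 1) {H : Finset (Finset V)}
    (h : H.Nonempty) : 0 < mu S p H :=
  Finset.sum_pos (fun A _ => wt_pos hp0 hp1 A) h

theorem nonempty_of_mu_pos {H : Finset (Finset V)} (h : 0 < mu S p H) : H.Nonempty := by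
  rw [Finset.nonempty_iff_ne_empty]
  rintro rfl
  simp [mu] at h

theorem mu_eq_card_mul {H : Finset (Finset V)} {k : ℕ} (h : ∀ A ∈ H, A.card = k) :
    mu S p H = H.card * (p ^ k * (1 - p) ^ (S.card - k)) := by
  unfold mu
  rw [← nsmul_eq_mul, ← Finset.sum_const]
  exact Finset.sum_congr rfl fun A hA => by simp [wt, h A hA]

theorem mu_powerset_card (S : Finset V) (p : ℝ) (r : ℕ) :
    mu S p (S.powerset.filter fun A => r ≤ A.card) =
      ∑ l ∈ Finset.Icc r S.card, (S.card.choose l : ℝ) * (p ^ l * (1 - p) ^ (S.card - l)) := by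
  unfold mu
  rw [← Finset.sum_fiberwise_of_maps_to (t := Finset.Icc r S.card) (g := Finset.card)]
  · refine Finset.sum_congr rfl fun l hl => ?_
    rw [← Finset.card_powersetCard l S, ← nsmul_eq_mul, ← Finset.sum_const]
    refine Finset.sum_congr ?_ ?_
    · ext A
      simp only [Finset.mem_filter, Finset.mem_powerset, Finset.mem_powersetCard, Finset.mem_Icc] at *
      constructor
      · rintro ⟨⟨h1, h2⟩, h3⟩
        exact ⟨h1, h3⟩
      · rintro ⟨h1, h2⟩
        exact ⟨⟨h1, h2 ▸ hl.1⟩, h2⟩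
    · intro A hA
      rw [Finset.mem_powersetCard] at hA
      simp [wt, hA.2]
  · intro A hA
    simp only [Finset.mem_filter, Finset.mem_powerset] at hA
    exact Finset.mem_Icc.2 ⟨hA.2, Finset.card_le_card hA.1⟩

theorem mu_le_of_le_card (hp0 : 0 < p) (hp1 : p < 1) {F : Finset (Finset V)} (r : ℕ)
    (hF : F ⊆ S.powerset) (h : ∀ A ∈ F, r ≤ A.card) :
    mu S p F ≤
      ∑ l ∈ Finset.Icc r S.card, (S.card.choose l : ℝ) * (p ^ l * (1 - p) ^ (S.card - l)) := by
  rw [← mu_powerset_card]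
  exact mu_mono hp0 hp1 fun A hA => Finset.mem_filter.2 ⟨hF hA, h A hA⟩

end weights

variable [DecidableEq V]

/-- Every member of `F` meets every member of `G` in at least two points. -/
def Cross (F G : Finset (Finset V)) : Prop :=
  ∀ A ∈ F, ∀ B ∈ G, 2 ≤ (A ∩ B).card

/-- A cross 2-intersecting pair of families of subsets of `S` with the largest measure product. -/
structure IsMaxPair (S : Finset V) (p : ℝ) (F G : Finset (Finset V)) : Prop where
  left : F ⊆ S.powerset
  right : G ⊆ S.powerset
  cross : Cross F G
  max : ∀ F' G' : Finset (Finset V), F' ⊆ S.powerset → G' ⊆ S.powerset → Cross F' G' →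
    mu S p F' * mu S p G' ≤ mu S p F * mu S p G

/-- `F` is closed under replacing `m` by any other element of `S`. -/
def Stable (S : Finset V) (m : V) (F : Finset (Finset V)) : Prop :=
  ∀ A ∈ F, m ∈ A → ∀ j ∈ S, j ∉ A → insert j (A.erase m) ∈ F

/-- The members of `F` that leave `F` when `m` is removed. -/
def bd (m : V) (F : Finset (Finset V)) : Finset (Finset V) :=
  F.filter fun A => m ∈ A ∧ A.erase m ∉ F

/-- The members of size `a` of `bd m F`. -/
def bdLevel (m : V) (F : Finset (Finset V)) (a : ℕ) : Finset (Finset V) :=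
  (bd m F).filter fun A => A.card = a

/-- `F` is closed under supersets inside `S`. -/
def Up (S : Finset V) (F : Finset (Finset V)) : Prop :=
  ∀ A ∈ F, ∀ B, A ⊆ B → B ⊆ S → B ∈ F

theorem Cross.symm {F G : Finset (Finset V)} (h : Cross F G) : Cross G F := by
  intro B hB A hA
  rw [Finset.inter_comm]
  exact h A hA B hB

theorem IsMaxPair.symm {S : Finset V} {p : ℝ} {F G : Finset (Finset V)}
    (h : IsMaxPair S p F G) : IsMaxPair S p G F where
  left := h.right
  right := h.left
  cross := h.cross.symm
  max F' G' hF hG hc := by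
    rw [mul_comm, mul_comm (mu S p G)]
    exact h.max G' F' hG hF hc.symm

/-! ### Maximal pairs. -/

section maximal

variable {S : Finset V} {p : ℝ} {F G : Finset (Finset V)}

theorem wt_erase {A : Finset V} {m : V} (hA : A ⊆ S) (hm : m ∈ A) :
    p * wt S p (A.erase m) = (1 - p) * wt S p A := by
  have h1 : (A.erase m).card + 1 = A.card := Finset.card_erase_add_one hm
  have h2 := Finset.card_le_card hA
  unfold wt
  have h3 : S.card - (A.erase m).card = (S.card - A.card) + 1 := by omega
  rw [h3, ← h1, pow_succ, pow_succ]
  ring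

theorem IsMaxPair.up (hp0 : 0 < p) (hp1 : p < 1) (h : IsMaxPair S p F G)
    (hG : 0 < mu S p G) : Up S F := by
  intro A hA B hAB hB
  by_contra hBF
  have hc : Cross (insert B F) G := by
    intro C hC D hD
    rcases Finset.mem_insert.1 hC with rfl | hC
    · exact (h.cross A hA D hD).trans (Finset.card_le_card (Finset.inter_subset_inter_right hAB))
    · exact h.cross C hC D hD
  have h1 := h.max (insert B F) G
    (Finset.insert_subset (Finset.mem_powerset.2 hB) h.left) h.right hc
  have h2 : mu S p (insert B F) = wt S p B + mu S p F := Finset.sum_insert hBF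
  rw [h2] at h1
  nlinarith [mul_pos (wt_pos (S := S) hp0 hp1 B) hG]

theorem exists_isMaxPair (S : Finset V) (p : ℝ) : ∃ F G, IsMaxPair S p F G := by
  classical
  let P := (S.powerset.powerset ×ˢ S.powerset.powerset).filter fun x => Cross x.1 x.2
  have hP : P.Nonempty := ⟨(∅, ∅), Finset.mem_filter.2
    ⟨by simp, fun A hA => absurd hA (Finset.notMem_empty A)⟩⟩
  obtain ⟨x, hx, hmax⟩ := P.exists_max_image (fun x => mu S p x.1 * mu S p x.2) hP
  simp only [P, Finset.mem_filter, Finset.mem_product, Finset.mem_powerset] at hx hmax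
  exact ⟨x.1, x.2, hx.1.1, hx.1.2, hx.2, fun F' G' h1 h2 h3 => hmax (F', G') ⟨⟨h1, h2⟩, h3⟩⟩

end maximal

/-! ### Shifting from `m` to the other points. -/

section shifting

/-- The replacement of `m` by `j` in `A`, unless it does not apply or its result is in `F`. -/
def shiftSet (m j : V) (F : Finset (Finset V)) (A : Finset V) : Finset V :=
  if m ∈ A ∧ j ∉ A ∧ insert j (A.erase m) ∉ F then insert j (A.erase m) else A

/-- The shift of the family `F` from `m` to `j`. -/
def shift (m j : V) (F : Finset (Finset V)) : Finset (Finset V) :=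
  F.image (shiftSet m j F)

variable {S : Finset V} {m j : V} {F G : Finset (Finset V)}

theorem card_shiftSet (A : Finset V) : (shiftSet m j F A).card = A.card := by
  unfold shiftSet
  split_ifs with h
  · rw [Finset.card_insert_of_notMem (fun h' => h.2.1 (Finset.mem_of_mem_erase h')),
      Finset.card_erase_add_one h.1]
  · rfl

theorem shiftSet_injOn : Set.InjOn (shiftSet m j F) F := by
  intro A hA B hB hAB
  unfold shiftSet at hAB
  split_ifs at hAB with h1 h2 h2
  · have h3 : ∀ C : Finset V, m ∈ C → j ∉ C →
        insert m ((insert j (C.erase m)).erase j) = C := by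
      intro C hm hj
      rw [Finset.erase_insert (fun h' => hj (Finset.mem_of_mem_erase h')), Finset.insert_erase hm]
    rw [← h3 A h1.1 h1.2.1, hAB, h3 B h2.1 h2.2.1]
  · exact absurd (hAB ▸ hB) h1.2.2
  · exact absurd (hAB ▸ hA) h2.2.2
  · exact hAB

theorem mu_shift (p : ℝ) : mu S p (shift m j F) = mu S p F := by
  unfold mu shift
  rw [Finset.sum_image shiftSet_injOn]
  exact Finset.sum_congr rfl fun A _ => by simp [wt, card_shiftSet]

theorem exists_card_of_shift {k : ℕ} (h : ∃ A ∈ shift m j F, A.card = k) :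
    ∃ A ∈ F, A.card = k := by
  obtain ⟨A, hA, hk⟩ := h
  obtain ⟨B, hB, rfl⟩ := Finset.mem_image.1 hA
  exact ⟨B, hB, by rw [← hk, card_shiftSet]⟩

theorem shift_subset (hj : j ∈ S) (hF : F ⊆ S.powerset) : shift m j F ⊆ S.powerset := by
  intro A hA
  obtain ⟨B, hB, rfl⟩ := Finset.mem_image.1 hA
  have hBS := Finset.mem_powerset.1 (hF hB)
  rw [Finset.mem_powerset]
  unfold shiftSet
  split_ifs
  · exact Finset.insert_subset hj ((Finset.erase_subset _ _).trans hBS)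
  · exact hBS

theorem card_inter_moved {A B : Finset V} (hj : j ∉ A)
    (hB : ¬(m ∈ B ∧ j ∉ B)) : (A ∩ B).card ≤ (insert j (A.erase m) ∩ B).card := by
  by_cases hjB : j ∈ B
  · rw [Finset.insert_inter_of_mem hjB, Finset.card_insert_of_notMem (by simp [hj]),
      Finset.erase_inter]
    have := Finset.pred_card_le_card_erase (s := A ∩ B) (a := m)
    omega
  · have hmB : m ∉ B := fun h => hB ⟨h, hjB⟩
    refine Finset.card_le_card fun x hx => ?_
    have := Finset.mem_inter.1 hx
    have hxm : x ≠ m := fun h => hmB (h ▸ this.2)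
    simp [this.1, this.2, hxm]

/-- If `B` stays only because its replacement is already in `G`, that replacement meets `A` in at
least two points, and these all lie in `B` and in the moved copy of `A`. -/
theorem card_inter_moved_stay (hc : Cross F G) {A B : Finset V} (hA : A ∈ F) (hB : B ∈ G)
    (hjA : j ∉ A) (h : ¬(m ∈ B ∧ j ∉ B ∧ insert j (B.erase m) ∉ G)) :
    2 ≤ (insert j (A.erase m) ∩ B).card := by
  by_cases hB' : m ∈ B ∧ j ∉ B
  · have h1 : insert j (B.erase m) ∈ G := by
      by_contra h2
      exact h ⟨hB'.1, hB'.2, h2⟩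
    refine (hc A hA _ h1).trans (Finset.card_le_card fun x hx => ?_)
    have := Finset.mem_inter.1 hx
    have hxj : x ≠ j := fun h => hjA (h ▸ this.1)
    have h3 := Finset.mem_of_mem_insert_of_ne this.2 hxj
    rw [Finset.mem_erase] at h3
    simp [this.1, h3.1, h3.2]
  · exact (hc A hA B hB).trans (card_inter_moved hjA hB')

theorem Cross.shift (hc : Cross F G) : Cross (shift m j F) (shift m j G) := by
  intro A' hA' B' hB'
  obtain ⟨A, hA, rfl⟩ := Finset.mem_image.1 hA'
  obtain ⟨B, hB, rfl⟩ := Finset.mem_image.1 hB'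
  unfold shiftSet
  split_ifs with h1 h2 h2
  · have h3 : A.erase m ∩ B.erase m = (A ∩ B).erase m := by
      ext x
      simp only [Finset.mem_inter, Finset.mem_erase]
      tauto
    rw [← Finset.insert_inter_distrib, h3, Finset.card_insert_of_notMem (by simp [h1.2.1]),
      Finset.card_erase_add_one (by simp [h1.1, h2.1])]
    exact hc A hA B hB
  · exact card_inter_moved_stay hc hA hB h1.2.1 h2
  · rw [Finset.inter_comm]
    exact card_inter_moved_stay hc.symm hB hA h2.2.1 h1
  · exact hc A hA B hB

theorem card_filter_shift_le (hjm : j ≠ m) :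
    ((shift m j F).filter fun A => m ∈ A).card ≤ (F.filter fun A => m ∈ A).card ∧
    (((shift m j F).filter fun A => m ∈ A).card = (F.filter fun A => m ∈ A).card →
      ∀ A ∈ F, m ∈ A → j ∉ A → insert j (A.erase m) ∈ F) := by
  have hsub : ((shift m j F).filter fun A => m ∈ A) ⊆ (F.filter fun A => m ∈ A) := by
    intro A hA
    obtain ⟨hA, hm⟩ := Finset.mem_filter.1 hA
    obtain ⟨B, hB, rfl⟩ := Finset.mem_image.1 hA
    unfold shiftSet at hm ⊢
    split_ifs at hm ⊢ with h
    · simp [hjm.symm] at hm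
    · exact Finset.mem_filter.2 ⟨hB, hm⟩
  refine ⟨Finset.card_le_card hsub, fun heq A hA hm hj => ?_⟩
  by_contra hn
  have h1 := Finset.eq_of_subset_of_card_le hsub heq.ge
  have h2 : A ∈ ((shift m j F).filter fun A => m ∈ A) := by
    rw [h1]
    exact Finset.mem_filter.2 ⟨hA, hm⟩
  obtain ⟨B, hB, hBA⟩ := Finset.mem_image.1 (Finset.mem_filter.1 h2).1
  have h3 : shiftSet m j F B ∈ F := hBA ▸ hA
  have h4 : B = A := by
    unfold shiftSet at hBA h3
    split_ifs at hBA h3 with h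
    · exact absurd h3 h.2.2
    · exact hBA
  subst h4
  unfold shiftSet at hBA
  rw [if_pos ⟨hm, hj, hn⟩] at hBA
  exact hj (hBA ▸ Finset.mem_insert_self _ _)

/-- A shift from `m` never increases the number of members containing `m`, and leaves it unchanged
only if the replacement property already holds, so a descent on this number ends at stable families.
Shifts preserve sizes; the clauses on 2-sets carry the equality case back to the original families.
-/
theorem exists_stable (S : Finset V) (p : ℝ) (m : V) (F G : Finset (Finset V))
    (hF : F ⊆ S.powerset) (hG : G ⊆ S.powerset) (hc : Cross F G) :
    ∃ F' G', F' ⊆ S.powerset ∧ G' ⊆ S.powerset ∧ Cross F' G' ∧ Stable S m F' ∧ Stable S m G' ∧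
      mu S p F' = mu S p F ∧ mu S p G' = mu S p G ∧
      ((∃ A ∈ F', A.card = 2) → ∃ A ∈ F, A.card = 2) ∧
      ((∃ A ∈ G', A.card = 2) → ∃ A ∈ G, A.card = 2) := by
  induction hN : (F.filter fun A => m ∈ A).card + (G.filter fun A => m ∈ A).card
    using Nat.strong_induction_on generalizing F G with
  | _ N ih =>
  by_cases hst : ∃ j ∈ S, j ≠ m ∧
      ((shift m j F).filter fun A => m ∈ A).card + ((shift m j G).filter fun A => m ∈ A).card < N
  · obtain ⟨j, hjS, hjm, hlt⟩ := hst
    obtain ⟨F', G', h1, h2, h3, h4, h5, h6, h7, h8, h9⟩ := ih _ hlt (shift m j F) (shift m j G)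
      (shift_subset hjS hF) (shift_subset hjS hG) hc.shift rfl
    exact ⟨F', G', h1, h2, h3, h4, h5, h6.trans (mu_shift p), h7.trans (mu_shift p),
      fun h => exists_card_of_shift (h8 h), fun h => exists_card_of_shift (h9 h)⟩
  · push Not at hst
    have key : ∀ j ∈ S, j ≠ m →
        (∀ A ∈ F, m ∈ A → j ∉ A → insert j (A.erase m) ∈ F) ∧
        (∀ A ∈ G, m ∈ A → j ∉ A → insert j (A.erase m) ∈ G) := by
      intro j hj hjm
      have h1 := card_filter_shift_le (F := F) hjm
      have h2 := card_filter_shift_le (F := G) hjm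
      have h3 := hst j hj hjm
      exact ⟨h1.2 (by omega), h2.2 (by omega)⟩
    refine ⟨F, G, hF, hG, hc, ?_, ?_, rfl, rfl, id, id⟩
    · intro A hA hm j hj hjA
      exact (key j hj (fun h => hjA (h ▸ hm))).1 A hA hm hjA
    · intro A hA hm j hj hjA
      exact (key j hj (fun h => hjA (h ▸ hm))).2 A hA hm hjA

end shifting

/-! ### The boundary at `m` and the exchange argument. -/

section boundary

variable {S : Finset V} {p : ℝ} {m : V} {F G : Finset (Finset V)}

theorem mem_bdLevel {a : ℕ} {A : Finset V} :
    A ∈ bdLevel m F a ↔ A ∈ F ∧ m ∈ A ∧ A.erase m ∉ F ∧ A.card = a := by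
  simp only [bdLevel, bd, Finset.mem_filter]
  tauto

theorem bdLevel_subset (a : ℕ) : bdLevel m F a ⊆ F := fun _ hA => (mem_bdLevel.1 hA).1

/-- Removing `m` from the boundary members of `F` of size `a` only creates conflicts with the
boundary members of `G` of size `|S| + 2 - a`. -/
theorem Cross.exchange (hG : G ⊆ S.powerset) (hF : F ⊆ S.powerset) (hc : Cross F G)
    (hst : Stable S m F) {a b : ℕ} (hab : a + b = S.card + 2) :
    Cross (F ∪ (bdLevel m F a).image fun A => A.erase m) (G \ bdLevel m G b) := by
  intro C hC B hB
  obtain ⟨hBG, hBb⟩ := Finset.mem_sdiff.1 hB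
  rcases Finset.mem_union.1 hC with hC | hC
  · exact hc C hC B hBG
  obtain ⟨A, hA, rfl⟩ := Finset.mem_image.1 hC
  obtain ⟨hAF, hmA, -, hAa⟩ := mem_bdLevel.1 hA
  by_cases hmB : m ∈ B
  · by_cases hB' : B.erase m ∈ G
    · rw [Finset.erase_inter, ← Finset.inter_erase]
      exact hc A hAF _ hB'
    · have hBcard : B.card ≠ b := fun h => hBb (mem_bdLevel.2 ⟨hBG, hmB, hB', h⟩)
      have h2 := hc A hAF B hBG
      rw [Finset.erase_inter, Finset.card_erase_of_mem (Finset.mem_inter.2 ⟨hmA, hmB⟩)]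
      -- Trouble arises only if `A` and `B` meet in exactly two points. Since `|A| + |B| ≠ |S| + 2`,
      -- some `j ∈ S` then lies outside `A ∪ B`, and replacing `m` by `j` in `A` gives a member of
      -- `F` that meets `B` only once.
      by_contra hlt
      have hsub : A ∪ B ⊆ S := Finset.union_subset (Finset.mem_powerset.1 (hF hAF))
        (Finset.mem_powerset.1 (hG hBG))
      have hne : A ∪ B ≠ S := by
        intro h
        have := Finset.card_union_add_card_inter A B
        rw [h] at this
        omega
      obtain ⟨j, hjS, hj⟩ := Finset.exists_of_ssubset (hsub.ssubset_of_ne hne)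
      rw [Finset.mem_union, not_or] at hj
      have h3 := hc _ (hst A hAF hmA j hjS hj.1) B hBG
      rw [Finset.insert_inter_of_notMem hj.2, Finset.erase_inter,
        Finset.card_erase_of_mem (Finset.mem_inter.2 ⟨hmA, hmB⟩)] at h3
      exact hlt h3
  · rw [Finset.erase_inter, ← Finset.inter_erase, Finset.erase_eq_of_notMem hmB]
    exact hc A hAF B hBG

theorem mu_image_erase {H : Finset (Finset V)} (hH : H ⊆ S.powerset) (hm : ∀ A ∈ H, m ∈ A) :
    p * mu S p (H.image fun A => A.erase m) = (1 - p) * mu S p H := by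
  unfold mu
  rw [Finset.sum_image, Finset.mul_sum, Finset.mul_sum]
  · exact Finset.sum_congr rfl fun A hA => wt_erase (Finset.mem_powerset.1 (hH hA)) (hm A hA)
  · intro A hA B hB h
    exact Finset.erase_injOn' m (hm A hA) (hm B hB) h

theorem mu_sdiff {H : Finset (Finset V)} (h : H ⊆ F) : mu S p (F \ H) = mu S p F - mu S p H := by
  unfold mu
  rw [← Finset.sum_sdiff h]
  ring

/-- Deleting `m` multiplies a weight by `(1 - p) / p`. With `x`, `y` the measures of `F`, `G` and
`w`, `v` those of the two levels, maximality reads `(x + (1 - p) / p * w) * (y - v) ≤ x * y`. -/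
theorem IsMaxPair.exchange_le (hp0 : 0 < p) (h : IsMaxPair S p F G) (hst : Stable S m F)
    {a b : ℕ} (hab : a + b = S.card + 2) :
    (1 - p) * mu S p (bdLevel m F a) * (mu S p G - mu S p (bdLevel m G b)) ≤
      p * mu S p F * mu S p (bdLevel m G b) := by
  set E := (bdLevel m F a).image fun A => A.erase m with hE
  have hdisj : Disjoint F E := by
    rw [Finset.disjoint_right]
    intro C hC
    obtain ⟨A, hA, rfl⟩ := Finset.mem_image.1 hC
    exact (mem_bdLevel.1 hA).2.2.1
  have hsub := (bdLevel_subset (m := m) (F := F) a).trans h.left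
  have hES : E ⊆ S.powerset := by
    intro C hC
    obtain ⟨A, hA, rfl⟩ := Finset.mem_image.1 hC
    exact Finset.mem_powerset.2
      ((Finset.erase_subset _ _).trans (Finset.mem_powerset.1 (hsub hA)))
  have h1 := h.max _ _ (Finset.union_subset h.left hES) (Finset.sdiff_subset.trans h.right)
    (h.cross.exchange h.right h.left hst hab)
  have h2 : mu S p (F ∪ E) = mu S p F + mu S p E := Finset.sum_union hdisj
  have h3 : p * mu S p E = _ := mu_image_erase hsub fun A hA => (mem_bdLevel.1 hA).2.1
  rw [h2, mu_sdiff (bdLevel_subset b)] at h1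
  have h4 := mul_le_mul_of_nonneg_left h1 hp0.le
  rw [← h3]
  nlinarith

theorem dominant_of_exchange {p x y w v : ℝ} (hp0 : 0 < p) (hp : p < 1 / 3) (hx : 0 < x)
    (hy : 0 < y) (hw : 0 < w) (hv : 0 ≤ v) (h1 : (1 - p) * w * (y - v) ≤ p * x * v)
    (h2 : (1 - p) * v * (x - w) ≤ p * y * w) : 0 < v ∧ (1 - 2 * p) * x ≤ (1 - p) * w := by
  have hp1 : 0 < 1 - p := by linarith
  have hv' : 0 < v := by
    rcases hv.lt_or_eq with h | h
    · exact h
    · subst h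
      have : 0 < (1 - p) * w * y := by positivity
      linarith
  refine ⟨hv', ?_⟩
  -- If `w` is too small, `h2` gives `v * x < y * w`; then `h1` makes `v` large relative to `y`,
  -- which gives the reverse comparison of `v * x` with `y * w`.
  by_contra! hlt
  have h3 : v * (p * x) < v * ((1 - p) * (x - w)) := mul_lt_mul_of_pos_left (by linarith) hv'
  have h4 : p * (v * x) < p * (y * w) := by linarith
  have h5 : v * x < y * w := lt_of_mul_lt_mul_left h4 hp0.le
  have h6 : w * ((1 - p) * (y - v)) < w * (p * y) := by linarith
  have h7 : (1 - p) * (y - v) < p * y := lt_of_mul_lt_mul_left h6 hw.le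
  have h8 : x * ((1 - 2 * p) * y) < x * ((1 - p) * v) := mul_lt_mul_of_pos_left (by linarith) hx
  have h9 : (1 - p) * (v * x) < (1 - p) * (y * w) := mul_lt_mul_of_pos_left h5 hp1
  have h10 : y * ((1 - p) * w) < y * ((1 - 2 * p) * x) := mul_lt_mul_of_pos_left hlt hy
  linarith

/-- For `p < 1/3` the ratio `(1 - 2p) / (1 - p)` exceeds `1/2`, so two disjoint levels cannot both
be dominant. -/
theorem bd_eq_bdLevel_of_dominant (hp0 : 0 < p) (hp : p < 1 / 3) {a : ℕ} (hF : 0 < mu S p F)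
    (hdom : ∀ c, (bdLevel m F c).Nonempty →
      (1 - 2 * p) * mu S p F ≤ (1 - p) * mu S p (bdLevel m F c))
    (ha : (bdLevel m F a).Nonempty) : bd m F = bdLevel m F a := by
  refine (Finset.filter_true_of_mem fun A hA => ?_).symm
  by_contra hne
  have hA' : A ∈ bdLevel m F A.card := Finset.mem_filter.2 ⟨hA, rfl⟩
  have h1 := hdom _ ⟨A, hA'⟩
  have h2 := hdom _ ha
  have hdisj : Disjoint (bdLevel m F A.card) (bdLevel m F a) := by
    rw [Finset.disjoint_left]
    intro B hB hB'
    exact hne ((mem_bdLevel.1 hB).2.2.2.symm.trans (mem_bdLevel.1 hB').2.2.2)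
  have h3 : mu S p (bdLevel m F A.card ∪ bdLevel m F a) = _ := Finset.sum_union hdisj
  have h4 := mu_mono (S := S) hp0 (by linarith)
    (Finset.union_subset (bdLevel_subset (m := m) (F := F) A.card)
      (bdLevel_subset (m := m) a))
  rw [h3] at h4
  change mu S p (bdLevel m F A.card) + mu S p (bdLevel m F a) ≤ mu S p F at h4
  nlinarith

/-- The boundary of a stable maximal pair is concentrated on one level on each side, and has more
than half of the measure. -/
theorem IsMaxPair.bd_single_level (hp0 : 0 < p) (hp : p < 1 / 3) (h : IsMaxPair S p F G)
    (hF : 0 < mu S p F) (hG : 0 < mu S p G) (hstF : Stable S m F) (hstG : Stable S m G)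
    (hne : (bd m F).Nonempty) :
    ∃ a b, a + b = S.card + 2 ∧
      ((bd m F).Nonempty ∧ (∀ A ∈ bd m F, A.card = a) ∧
        (1 - 2 * p) * mu S p F ≤ (1 - p) * mu S p (bd m F)) ∧
      ((bd m G).Nonempty ∧ (∀ A ∈ bd m G, A.card = b) ∧
        (1 - 2 * p) * mu S p G ≤ (1 - p) * mu S p (bd m G)) := by
  have hp1 : p < 1 := by linarith
  have key : ∀ {F G : Finset (Finset V)}, IsMaxPair S p F G → 0 < mu S p F → 0 < mu S p G →
      Stable S m F → Stable S m G → ∀ c d, c + d = S.card + 2 → (bdLevel m F c).Nonempty →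
      (bdLevel m G d).Nonempty ∧ (1 - 2 * p) * mu S p F ≤ (1 - p) * mu S p (bdLevel m F c) := by
    intro F G h hF hG hstF hstG c d hcd hc
    have h1 := h.exchange_le hp0 hstF hcd
    have h2 := h.symm.exchange_le hp0 hstG (a := d) (b := c) (by omega)
    have h3 := dominant_of_exchange hp0 hp hF hG (mu_pos_of_nonempty hp0 hp1 hc)
      (mu_nonneg hp0 hp1 _) h1 h2
    exact ⟨nonempty_of_mu_pos h3.1, h3.2⟩
  have hle : ∀ {F G : Finset (Finset V)}, IsMaxPair S p F G → ∀ c, (bdLevel m F c).Nonempty →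
      c ≤ S.card := by
    rintro F G h c ⟨A, hA⟩
    obtain ⟨h1, -, -, rfl⟩ := mem_bdLevel.1 hA
    exact Finset.card_le_card (Finset.mem_powerset.1 (h.left h1))
  obtain ⟨A, hA⟩ := hne
  have hFa : (bdLevel m F A.card).Nonempty := ⟨A, Finset.mem_filter.2 ⟨hA, rfl⟩⟩
  have hab : A.card + (S.card + 2 - A.card) = S.card + 2 := by
    have := hle h _ hFa
    omega
  obtain ⟨hGb, hFd⟩ := key h hF hG hstF hstG _ _ hab hFa
  obtain ⟨-, hGd⟩ := key h.symm hG hF hstG hstF _ _ ((Nat.add_comm _ _).trans hab) hGb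
  have hFeq := bd_eq_bdLevel_of_dominant hp0 hp hF (fun c hc =>
    (key h hF hG hstF hstG c (S.card + 2 - c) (by have := hle h c hc; omega) hc).2) hFa
  have hGeq := bd_eq_bdLevel_of_dominant hp0 hp hG (fun c hc =>
    (key h.symm hG hF hstG hstF c (S.card + 2 - c)
      (by have := hle h.symm c hc; omega) hc).2) hGb
  refine ⟨_, _, hab, ⟨hFeq ▸ hFa, fun B hB => ?_, hFeq ▸ hFd⟩,
    ⟨hGeq ▸ hGb, fun B hB => ?_, hGeq ▸ hGd⟩⟩
  · rw [hFeq] at hB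
    exact (mem_bdLevel.1 hB).2.2.2
  · rw [hGeq] at hB
    exact (mem_bdLevel.1 hB).2.2.2

/-- The members containing `m` outside the boundary are matched by deletion of `m` with the members
avoiding `m`, at weight ratio `p / (1 - p)`. -/
theorem mu_eq_of_up (hF : F ⊆ S.powerset) (hm : m ∈ S) (hup : Up S F) :
    (1 - p) * mu S p F =
      (1 - p) * mu S p (bd m F) + mu S p (F.filter fun A => m ∉ A) := by
  have h1 : mu S p F = mu S p (F.filter fun A => m ∈ A) + mu S p (F.filter fun A => m ∉ A) :=
    (Finset.sum_filter_add_sum_filter_not F _ _).symm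
  set K := F.filter fun A => m ∈ A ∧ A.erase m ∈ F with hK
  have h2 : mu S p (F.filter fun A => m ∈ A) = mu S p K + mu S p (bd m F) := by
    unfold mu
    rw [← Finset.sum_filter_add_sum_filter_not (F.filter fun A => m ∈ A)
      (fun A => A.erase m ∈ F), Finset.filter_filter, Finset.filter_filter]
    rfl
  have h3 : (K.image fun A => A.erase m) = F.filter fun A => m ∉ A := by
    ext A
    simp only [hK, Finset.mem_image, Finset.mem_filter]
    constructor
    · rintro ⟨B, ⟨-, -, h⟩, rfl⟩
      exact ⟨h, Finset.notMem_erase _ _⟩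
    · rintro ⟨hA, hmA⟩
      refine ⟨insert m A, ⟨hup A hA _ (Finset.subset_insert _ _)
        (Finset.insert_subset hm (Finset.mem_powerset.1 (hF hA))),
        Finset.mem_insert_self _ _, ?_⟩, Finset.erase_insert hmA⟩
      rwa [Finset.erase_insert hmA]
  have h4 := mu_image_erase (S := S) (p := p) (m := m) (H := K)
    ((Finset.filter_subset _ _).trans hF) (fun A hA => (Finset.mem_filter.1 hA).2.1)
  rw [h3] at h4
  rw [h1, h2]
  linarith

theorem mu_notMem_le (hF : F ⊆ S.powerset) (hm : m ∈ S) (hup : Up S F) (hp : p < 1)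
    (hdom : (1 - 2 * p) * mu S p F ≤ (1 - p) * mu S p (bd m F)) :
    (1 - 2 * p) * mu S p (F.filter fun A => m ∉ A) ≤ p * (1 - p) * mu S p (bd m F) := by
  have h1 := mu_eq_of_up (p := p) hF hm hup
  have h2 := mul_le_mul_of_nonneg_left hdom (by linarith : 0 ≤ 1 - p)
  have h3 : (1 - 2 * p) * ((1 - p) * mu S p F) ≤ (1 - p) * ((1 - p) * mu S p (bd m F)) := by
    linarith
  rw [h1] at h3
  linarith

/-- Double counting of the covering pairs between two consecutive levels. -/
theorem card_mul_le_card_mul_of_covers {T : Finset V} {k : ℕ} {K N : Finset (Finset V)}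
    (hK : ∀ A ∈ K, A ⊆ T ∧ A.card = k) (hN : ∀ C ∈ N, C.card = k + 1)
    (h : ∀ A ∈ K, ∀ x ∈ T, x ∉ A → insert x A ∈ N) :
    (T.card - k) * K.card ≤ (k + 1) * N.card := by
  rw [mul_comm, mul_comm (k + 1)]
  refine Finset.card_mul_le_card_mul (fun A C => A ⊆ C) (fun A hA => ?_) (fun C hC => ?_)
  · obtain ⟨hAT, hAk⟩ := hK A hA
    rw [← hAk, ← Finset.card_sdiff_of_subset hAT,
      ← Finset.card_image_of_injOn (s := T \ A) (f := fun x => insert x A)]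
    · refine Finset.card_le_card fun C hC => ?_
      obtain ⟨x, hx, rfl⟩ := Finset.mem_image.1 hC
      rw [Finset.mem_sdiff] at hx
      exact Finset.mem_filter.2 ⟨h A hA x hx.1 hx.2, Finset.subset_insert _ _⟩
    · intro x hx y hy hxy
      have hx' := (Finset.mem_sdiff.1 hx).2
      have h1 : x ∈ insert y A := by
        change insert x A = insert y A at hxy
        rw [← hxy]
        exact Finset.mem_insert_self _ _
      exact (Finset.mem_insert.1 h1).resolve_right hx'
  · refine le_trans (Finset.card_le_card (t := C.image fun x => C.erase x) fun A hA => ?_)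
      (Finset.card_image_le.trans (hN C hC).le)
    obtain ⟨hAK, hAC⟩ := Finset.mem_filter.1 hA
    have h1 : (C \ A).card = 1 := by
      rw [Finset.card_sdiff_of_subset hAC, hN C hC, (hK A hAK).2]
      omega
    obtain ⟨x, hx⟩ := Finset.card_eq_one.1 h1
    have hxC : x ∈ C \ A := hx ▸ Finset.mem_singleton_self x
    refine Finset.mem_image.2 ⟨x, (Finset.mem_sdiff.1 hxC).1, ?_⟩
    rw [← Finset.sdiff_singleton_eq_erase, ← hx, Finset.sdiff_sdiff_eq_self hAC]

end boundary

/-! ### Reduction to finitely many sizes and levels. -/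

section classification

variable {S : Finset V} {p : ℝ} {m : V} {F G : Finset (Finset V)}

theorem three_mul_lt_of_weights {p : ℝ} (hp0 : 0 < p) (hp : p < 1 / 3) {h j n s a : ℕ}
    (hh : 0 < h) (ha : 1 ≤ a) (has : a ≤ s)
    (hw : (1 - 2 * p) * (n * (p ^ a * (1 - p) ^ (s - a)) +
        j * (p ^ (a - 1) * (1 - p) ^ (s - (a - 1)))) ≤
      p * (1 - p) * (h * (p ^ a * (1 - p) ^ (s - a)))) :
    3 * (n + 2 * j) < 2 * h := by
  have hq : 0 < 1 - p := by linarith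
  obtain ⟨c, rfl⟩ : ∃ c, a = c + 1 := ⟨a - 1, by omega⟩
  rw [Nat.add_sub_cancel, (by omega : s - c = (s - (c + 1)) + 1), pow_succ, pow_succ] at hw
  set u : ℝ := p ^ c * (1 - p) ^ (s - (c + 1)) with hu
  have hu0 : 0 < u := by positivity
  have h1 : u * ((1 - 2 * p) * (n * p + j * (1 - p))) ≤ u * (p * (1 - p) * (h * p)) := by
    rw [hu]
    linarith
  have h2 := le_of_mul_le_mul_left h1 hu0
  -- A set one level lower weighs `(1 - p) / p ≥ 2` times as much, whence the coefficient of `j`.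
  have h3 : p * ((1 - 2 * p) * (n + 2 * j)) ≤ p * (p * (1 - p) * h) := by
    have h4 : (j : ℝ) * (2 * p) ≤ j * (1 - p) :=
      mul_le_mul_of_nonneg_left (by linarith) (Nat.cast_nonneg j)
    have h5 := mul_le_mul_of_nonneg_left h4 (by linarith : (0 : ℝ) ≤ 1 - 2 * p)
    linarith
  have h4 := le_of_mul_le_mul_left h3 hp0
  have hh' : (0 : ℝ) < h := by exact_mod_cast hh
  -- The difference of the coefficients is `(1 - 3p)(2 - p)`, positive for `p < 1/3`.
  have h5 : 3 * (p * (1 - p)) * h < 2 * (1 - 2 * p) * h :=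
    mul_lt_mul_of_pos_right (by nlinarith) hh'
  have h6 : (1 - 2 * p) * (3 * (n + 2 * j)) < (1 - 2 * p) * (2 * h) := by linarith
  have h7 := lt_of_mul_lt_mul_left h6 (by linarith)
  exact_mod_cast h7

/-- Numerical constraints on a stable family whose boundary lies on level `a` and is dominant. -/
theorem single_level_counts (hp0 : 0 < p) (hp : p < 1 / 3) (hF : F ⊆ S.powerset) (hm : m ∈ S)
    (hup : Up S F) (hst : Stable S m F) {a : ℕ} (hne : (bd m F).Nonempty)
    (hlev : ∀ A ∈ bd m F, A.card = a)
    (hdom : (1 - 2 * p) * mu S p F ≤ (1 - p) * mu S p (bd m F)) :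
    1 ≤ a ∧ a ≤ S.card ∧ ∃ h j n : ℕ, 0 < h ∧ (S.card - a) * (h + j) ≤ a * n ∧
      h + j ≤ (S.card - 1).choose (a - 1) ∧ 3 * (n + 2 * j) < 2 * h ∧
      (j = 0 → ∀ A ∈ F, a ≤ A.card) := by
  have hbdF : bd m F ⊆ F := Finset.filter_subset _ _
  have hbdm : ∀ A ∈ bd m F, m ∈ A := fun A hA => (Finset.mem_filter.1 hA).2.1
  have ha : 1 ≤ a ∧ a ≤ S.card := by
    obtain ⟨A, hA⟩ := hne
    rw [← hlev A hA]
    exact ⟨Finset.card_pos.2 ⟨m, hbdm A hA⟩,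
      Finset.card_le_card (Finset.mem_powerset.1 (hF (hbdF hA)))⟩
  have hTcard := Finset.card_erase_of_mem hm
  -- The sets in `H` have size `a - 1` and are not in `F`, while those in `J` have the same size and
  -- are. Every one-point extension inside `S.erase m` lies in `N`: by stability for `H`, by upward
  -- closure for `J`. The witnesses `h`, `j`, `n` are the sizes of `bd m F`, `J`, `N`.
  set H := (bd m F).image fun A => A.erase m with hH
  set J := F.filter fun A => m ∉ A ∧ A.card = a - 1 with hJ
  set N := F.filter fun A => m ∉ A ∧ A.card = a with hN
  have hHcard : H.card = (bd m F).card := Finset.card_image_of_injOn fun A hA B hB h =>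
    Finset.erase_injOn' m (hbdm A hA) (hbdm B hB) h
  have hHJ : Disjoint H J := by
    rw [Finset.disjoint_left]
    intro C hC hCJ
    obtain ⟨A, hA, rfl⟩ := Finset.mem_image.1 hC
    exact (Finset.mem_filter.1 hA).2.2 (Finset.mem_filter.1 hCJ).1
  have hK : ∀ A ∈ H ∪ J, A ⊆ S.erase m ∧ A.card = a - 1 := by
    intro C hC
    rcases Finset.mem_union.1 hC with hC | hC
    · obtain ⟨A, hA, rfl⟩ := Finset.mem_image.1 hC
      exact ⟨Finset.erase_subset_erase m (Finset.mem_powerset.1 (hF (hbdF hA))),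
        by rw [Finset.card_erase_of_mem (hbdm A hA), hlev A hA]⟩
    · obtain ⟨h1, h2, h3⟩ := Finset.mem_filter.1 hC
      exact ⟨Finset.subset_erase.2 ⟨Finset.mem_powerset.1 (hF h1), h2⟩, h3⟩
  have hcov : ∀ A ∈ H ∪ J, ∀ x ∈ S.erase m, x ∉ A → insert x A ∈ N := by
    intro C hC x hx hxC
    obtain ⟨hxm, hxS⟩ := Finset.mem_erase.1 hx
    obtain ⟨hCS, hCa⟩ := hK C hC
    have hmC : m ∉ C := fun h => Finset.notMem_erase m S (hCS h)
    refine Finset.mem_filter.2 ⟨?_, by simp [hxm.symm, hmC],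
      by rw [Finset.card_insert_of_notMem hxC]; omega⟩
    rcases Finset.mem_union.1 hC with hC | hC
    · obtain ⟨A, hA, rfl⟩ := Finset.mem_image.1 hC
      exact hst A (hbdF hA) (hbdm A hA) x hxS fun h => hxC (Finset.mem_erase.2 ⟨hxm, h⟩)
    · exact hup C (Finset.mem_filter.1 hC).1 _ (Finset.subset_insert _ _)
        (Finset.insert_subset hxS (hCS.trans (Finset.erase_subset _ _)))
  have h1 := card_mul_le_card_mul_of_covers hK (N := N)
    (fun C hC => by have := (Finset.mem_filter.1 hC).2.2; omega) hcov
  have h2 : (H ∪ J).card ≤ ((S.erase m).powersetCard (a - 1)).card :=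
    Finset.card_le_card fun A hA => Finset.mem_powersetCard.2 (hK A hA)
  rw [Finset.card_powersetCard] at h2
  rw [Finset.card_union_of_disjoint hHJ, hTcard] at h1 h2
  rw [hHcard] at h1 h2
  refine ⟨ha.1, ha.2, (bd m F).card, J.card, N.card, Finset.card_pos.2 hne, ?_, h2, ?_, ?_⟩
  · have e1 : S.card - 1 - (a - 1) = S.card - a := by omega
    have e2 : a - 1 + 1 = a := by omega
    rwa [e1, e2] at h1
  · have h3 := mu_notMem_le hF hm hup (by linarith) hdom
    have hNJ : Disjoint N J := by
      rw [Finset.disjoint_left]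
      intro C hC hCJ
      have := (Finset.mem_filter.1 hC).2.2
      have := (Finset.mem_filter.1 hCJ).2.2
      omega
    have h4 : mu S p (N ∪ J) ≤ mu S p (F.filter fun A => m ∉ A) := by
      refine mu_mono hp0 (by linarith) (Finset.union_subset ?_ ?_) <;>
      · intro C hC
        exact Finset.mem_filter.2 ⟨(Finset.mem_filter.1 hC).1, (Finset.mem_filter.1 hC).2.1⟩
    have h5 : mu S p (N ∪ J) = mu S p N + mu S p J := Finset.sum_union hNJ
    rw [h5, mu_eq_card_mul (k := a) fun C hC => (Finset.mem_filter.1 hC).2.2,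
      mu_eq_card_mul (k := a - 1) fun C hC => (Finset.mem_filter.1 hC).2.2] at h4
    rw [mu_eq_card_mul hlev] at h3
    exact three_mul_lt_of_weights hp0 hp (Finset.card_pos.2 hne) ha.1 ha.2
      ((mul_le_mul_of_nonneg_left h4 (by linarith)).trans h3)
  · intro hJ0
    -- A smaller member avoiding `m` could be enlarged within `S.erase m` to a member of `J`.
    have hnot : ∀ A ∈ F, m ∉ A → a ≤ A.card := by
      intro A hA hmA
      by_contra! hlt
      obtain ⟨B, hAB, hBS, hB⟩ := Finset.exists_subsuperset_card_eq
        (Finset.subset_erase.2 ⟨Finset.mem_powerset.1 (hF hA), hmA⟩)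
        (by omega : A.card ≤ a - 1) (by omega)
      have : B ∈ J := Finset.mem_filter.2 ⟨hup A hA B hAB (hBS.trans (Finset.erase_subset _ _)),
        fun h => Finset.notMem_erase m S (hBS h), hB⟩
      rw [Finset.card_eq_zero.1 hJ0] at this
      exact Finset.notMem_empty _ this
    intro A hA
    by_cases hmA : m ∈ A
    · by_cases hA' : A.erase m ∈ F
      · exact (hnot _ hA' (Finset.notMem_erase _ _)).trans (Finset.card_erase_le)
      · exact (hlev A (Finset.mem_filter.2 ⟨hA, hmA, hA'⟩)).ge
    · exact hnot A hA hmA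

theorem ratio_lt_of_counts {s a h j n : ℕ} (h2 : (s - a) * (h + j) ≤ a * n)
    (h3 : 3 * (n + 2 * j) < 2 * h) (ha : 1 ≤ a) : 3 * (s - a) < 2 * a := by
  by_contra! hle
  have e1 := Nat.mul_le_mul_right (h + j) hle
  have e2 : a * (3 * (n + 2 * j)) < a * (2 * h) := Nat.mul_lt_mul_of_pos_left h3 ha
  nlinarith

/-- Adding `3s < 5a` and `3s < 5b` gives `6s < 5(s + 2)`, so `s < 10`. -/
theorem level_cases {s a b : ℕ} (hab : a + b = s + 2) (ha : a ≤ s) (hb : b ≤ s)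
    (ra : 3 * (s - a) < 2 * a) (rb : 3 * (s - b) < 2 * b) :
    (s = 2 ∧ a = 2 ∧ b = 2) ∨ (s = 3 ∧ a = 2 ∧ b = 3) ∨ (s = 3 ∧ a = 3 ∧ b = 2) ∨
      (((s = 4 ∧ a = 3) ∨ (s = 6 ∧ a = 4) ∨ (s = 8 ∧ a = 5)) ∧ a = b) := by
  have ea : 3 * s < 5 * a := by omega
  have eb : 3 * s < 5 * b := by omega
  clear ra rb
  obtain rfl : b = s + 2 - a := by omega
  have hs : s < 10 := by omega
  interval_cases s <;> interval_cases a <;> omega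

/-- Eliminating `n` shows that `j ≥ 1` would force `h` above the binomial coefficient. -/
theorem no_lower_sets_of_counts {s a h j n : ℕ}
    (hsa : (s = 2 ∧ a = 2) ∨ (s = 3 ∧ a = 2) ∨ (s = 3 ∧ a = 3) ∨ (s = 4 ∧ a = 3) ∨
      (s = 6 ∧ a = 4) ∨ (s = 8 ∧ a = 5)) (h2 : (s - a) * (h + j) ≤ a * n)
    (h3 : h + j ≤ (s - 1).choose (a - 1)) (h4 : 3 * (n + 2 * j) < 2 * h) : j = 0 := by
  rcases hsa with ⟨rfl, rfl⟩ | ⟨rfl, rfl⟩ | ⟨rfl, rfl⟩ | ⟨rfl, rfl⟩ | ⟨rfl, rfl⟩ | ⟨rfl, rfl⟩ <;>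
  · norm_num [Nat.choose] at h2 h3
    omega

/-- The tails are polynomials in `p ^ 2 < 1/9` and `p * (1 - p) < 2/9`. The exception `s = 3`, `a =
2` may exceed `p ^ 2`, but is always paired with `b = 3`, whose tail is `p ^ 3`. -/
theorem tail_bounds {p : ℝ} (hp0 : 0 < p) (hp : p < 1 / 3) {s a : ℕ} {x : ℝ}
    (hx : x ≤ ∑ l ∈ Finset.Icc a s, (s.choose l : ℝ) * (p ^ l * (1 - p) ^ (s - l))) :
    (s = 2 → a = 2 → x ≤ p ^ 2) ∧ (s = 3 → a = 2 → x ≤ p ^ 2 * (3 - 2 * p)) ∧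
    (s = 3 → a = 3 → x ≤ p ^ 3) ∧
    ((s = 4 ∧ a = 3) ∨ (s = 6 ∧ a = 4) ∨ (s = 8 ∧ a = 5) → x < p ^ 2) := by
  have hp2 : 0 < p ^ 2 := by positivity
  have hpp : p ^ 2 < 1 / 9 := by nlinarith
  have hq : p * (1 - p) < 2 / 9 := by nlinarith
  have hq0 : 0 < p * (1 - p) := mul_pos hp0 (by linarith)
  refine ⟨?_, ?_, ?_, ?_⟩
  · rintro rfl rfl
    simpa using hx
  · rintro rfl rfl
    norm_num [Finset.sum_Icc_succ_top, Nat.choose] at hx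
    linarith
  · rintro rfl rfl
    simpa using hx
  · have main : ∀ c, c < 1 → x ≤ p ^ 2 * c → x < p ^ 2 := fun c hc hxc => by nlinarith
    rintro (⟨rfl, rfl⟩ | ⟨rfl, rfl⟩ | ⟨rfl, rfl⟩) <;>
      norm_num [Finset.sum_Icc_succ_top, Nat.choose] at hx
    · refine main (4 * (p * (1 - p)) + p ^ 2) ?_ (hx.trans (by linarith))
      nlinarith
    · refine main (15 * (p * (1 - p)) ^ 2 + 6 * p ^ 2 * (p * (1 - p)) + (p ^ 2) ^ 2) ?_
        (hx.trans (by linarith))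
      have e1 : (p * (1 - p)) ^ 2 ≤ (2 / 9) ^ 2 := pow_le_pow_left₀ hq0.le hq.le 2
      have e2 : p ^ 2 * (p * (1 - p)) ≤ 1 / 9 * (2 / 9) :=
        mul_le_mul hpp.le hq.le hq0.le (by norm_num)
      have e3 : (p ^ 2) ^ 2 ≤ (1 / 9) ^ 2 := pow_le_pow_left₀ hp2.le hpp.le 2
      norm_num at e1 e2 e3
      linarith
    · refine main (56 * (p * (1 - p)) ^ 3 + 28 * (p ^ 2 * (p * (1 - p)) ^ 2) +
        8 * ((p ^ 2) ^ 2 * (p * (1 - p))) + (p ^ 2) ^ 3) ?_ (hx.trans (by linarith))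
      have e1 : (p * (1 - p)) ^ 3 ≤ (2 / 9) ^ 3 := pow_le_pow_left₀ hq0.le hq.le 3
      have e2 : p ^ 2 * (p * (1 - p)) ^ 2 ≤ 1 / 9 * (2 / 9) ^ 2 :=
        mul_le_mul hpp.le (pow_le_pow_left₀ hq0.le hq.le 2) (by positivity) (by norm_num)
      have e3 : (p ^ 2) ^ 2 * (p * (1 - p)) ≤ (1 / 9) ^ 2 * (2 / 9) :=
        mul_le_mul (pow_le_pow_left₀ hp2.le hpp.le 2) hq.le hq0.le (by norm_num)
      have e4 : (p ^ 2) ^ 3 ≤ (1 / 9) ^ 3 := pow_le_pow_left₀ hp2.le hpp.le 3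
      norm_num at e1 e2 e3 e4
      linarith

/-- A stable maximal pair that depends on `m` is a star based on a pair, or is too small. -/
theorem IsMaxPair.bound_of_bd_nonempty (hp0 : 0 < p) (hp : p < 1 / 3) (h : IsMaxPair S p F G)
    (hF : 0 < mu S p F) (hG : 0 < mu S p G) (hm : m ∈ S) (hstF : Stable S m F)
    (hstG : Stable S m G) (hne : (bd m F).Nonempty) :
    mu S p F * mu S p G < p ^ 4 ∨
      (mu S p F * mu S p G ≤ p ^ 4 ∧ (∃ A ∈ F, A.card = 2) ∧ ∃ A ∈ G, A.card = 2) := by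
  have hp1 : p < 1 := by linarith
  obtain ⟨a, b, hab, ⟨hFne, hFlev, hFdom⟩, hGne, hGlev, hGdom⟩ :=
    h.bd_single_level hp0 hp hF hG hstF hstG hne
  obtain ⟨ha1, has, h₁, j₁, n₁, -, r₁, c₁, w₁, k₁⟩ := single_level_counts hp0 hp h.left hm
    (h.up hp0 hp1 hG) hstF hFne hFlev hFdom
  obtain ⟨hb1, hbs, h₂, j₂, n₂, -, r₂, c₂, w₂, k₂⟩ := single_level_counts hp0 hp h.right hm
    (h.symm.up hp0 hp1 hF) hstG hGne hGlev hGdom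
  have ra := ratio_lt_of_counts r₁ w₁ ha1
  have rb := ratio_lt_of_counts r₂ w₂ hb1
  have hcases := level_cases hab has hbs ra rb
  have hA := mu_le_of_le_card hp0 hp1 a h.left
    (k₁ (no_lower_sets_of_counts (by clear * - hcases; omega) r₁ c₁ w₁))
  have hB := mu_le_of_le_card hp0 hp1 b h.right
    (k₂ (no_lower_sets_of_counts (by clear * - hcases; omega) r₂ c₂ w₂))
  obtain ⟨A₁, A₂, A₃, A₄⟩ := tail_bounds hp0 hp hA
  obtain ⟨B₁, B₂, B₃, B₄⟩ := tail_bounds hp0 hp hB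
  have hp4 : p ^ 4 = p ^ 2 * p ^ 2 := by ring
  have hsmall : p ^ 2 * (3 - 2 * p) * p ^ 3 < p ^ 4 := by
    have h1 : p * (3 - 2 * p) < 1 := by nlinarith
    have h2 : p ^ 4 * (p * (3 - 2 * p)) < p ^ 4 * 1 := mul_lt_mul_of_pos_left h1 (by positivity)
    linarith
  have hsmall0 : 0 < p ^ 2 * (3 - 2 * p) := mul_pos (by positivity) (by linarith)
  rcases hcases with ⟨hs, rfl, rfl⟩ | ⟨hs, rfl, rfl⟩ | ⟨hs, rfl, rfl⟩ | ⟨hs, rfl⟩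
  -- Only `s = a = b = 2` can attain `p ^ 4`; the nonempty boundaries supply the 2-sets.
  · right
    obtain ⟨A, hA⟩ := hFne
    obtain ⟨B, hB⟩ := hGne
    exact ⟨hp4 ▸ mul_le_mul (A₁ hs rfl) (B₁ hs rfl) hG.le (by positivity),
      ⟨A, (Finset.mem_filter.1 hA).1, hFlev A hA⟩, ⟨B, (Finset.mem_filter.1 hB).1, hGlev B hB⟩⟩
  · left
    exact (mul_le_mul (A₂ hs rfl) (B₃ hs rfl) hG.le hsmall0.le).trans_lt hsmall
  · left
    rw [mul_comm]
    exact (mul_le_mul (B₂ hs rfl) (A₃ hs rfl) hF.le hsmall0.le).trans_lt hsmall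
  · left
    rw [hp4]
    exact mul_lt_mul'' (A₄ hs) (B₄ hs) hF.le hG.le

/-- With empty boundary, membership does not depend on `m`, so this coordinate sums out. -/
theorem mu_eq_mu_erase (hp1 : p < 1) (hF : F ⊆ S.powerset) (hm : m ∈ S) (hup : Up S F)
    (hbd : bd m F = ∅) :
    mu S p F = mu (S.erase m) p (F.filter fun A => m ∉ A) := by
  have h1 := mu_eq_of_up (p := p) hF hm hup
  have h2 : mu S p (F.filter fun A => m ∉ A) =
      (1 - p) * mu (S.erase m) p (F.filter fun A => m ∉ A) := by
    unfold mu
    rw [Finset.mul_sum]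
    refine Finset.sum_congr rfl fun A hA => ?_
    obtain ⟨hAF, hmA⟩ := Finset.mem_filter.1 hA
    have h3 := Finset.card_le_card
      (Finset.subset_erase.2 ⟨Finset.mem_powerset.1 (hF hAF), hmA⟩)
    have h4 := Finset.card_erase_add_one hm
    unfold wt
    rw [(by omega : S.card - A.card = ((S.erase m).card - A.card) + 1), pow_succ]
    ring
  rw [hbd, h2] at h1
  have h3 : (1 - p) * mu S p F =
      (1 - p) * mu (S.erase m) p (F.filter fun A => m ∉ A) := by
    simpa [mu] using h1
  exact mul_left_cancel₀ (by linarith) h3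

end classification

/-! ### The induction on the ground set. -/

theorem mu_mul_mu_le {p : ℝ} (hp0 : 0 < p) (hp : p < 1 / 3) (S : Finset V) :
    ∀ F G : Finset (Finset V), F ⊆ S.powerset → G ⊆ S.powerset → Cross F G →
      mu S p F * mu S p G ≤ p ^ 4 ∧ (mu S p F * mu S p G = p ^ 4 →
        (∃ A ∈ F, A.card = 2) ∧ ∃ A ∈ G, A.card = 2) := by
  have hp1 : p < 1 := by linarith
  have hp4 : 0 < p ^ 4 := by positivity
  induction hN : S.card generalizing S with
  | zero =>
    intro F G hF hG hc
    have h0 : mu S p F * mu S p G = 0 := by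
      by_contra hne
      obtain ⟨A, hA⟩ := nonempty_of_mu_pos
        ((mu_nonneg hp0 hp1 F).lt_of_ne' (left_ne_zero_of_mul hne))
      obtain ⟨B, hB⟩ := nonempty_of_mu_pos
        ((mu_nonneg hp0 hp1 G).lt_of_ne' (right_ne_zero_of_mul hne))
      have h1 := hc A hA B hB
      have h2 := Finset.card_le_card
        (Finset.inter_subset_left.trans (Finset.mem_powerset.1 (hF hA)) : A ∩ B ⊆ S)
      omega
    rw [h0]
    exact ⟨hp4.le, fun h => absurd h hp4.ne⟩
  | succ N ih =>
    obtain ⟨m, hm⟩ : S.Nonempty := Finset.card_pos.1 (by omega)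
    have ih' := ih (S.erase m) (by rw [Finset.card_erase_of_mem hm]; omega)
    -- One statement serves both claims: it refutes a product above `p ^ 4` and treats equality,
    -- where the given pair is itself maximal.
    have key : ∀ F G, IsMaxPair S p F G → p ^ 4 ≤ mu S p F * mu S p G →
        mu S p F * mu S p G = p ^ 4 ∧ (∃ A ∈ F, A.card = 2) ∧ ∃ A ∈ G, A.card = 2 := by
      intro F₀ G₀ h₀ hge
      obtain ⟨F, G, hF, hG, hc, hsF, hsG, eF, eG, tF, tG⟩ :=
        exists_stable S p m F₀ G₀ h₀.left h₀.right h₀.cross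
      have h : IsMaxPair S p F G := ⟨hF, hG, hc, by rw [eF, eG]; exact h₀.max⟩
      rw [← eF, ← eG] at hge ⊢
      have hpos := hp4.trans_le hge
      have hF0 : 0 < mu S p F :=
        (mu_nonneg hp0 hp1 F).lt_of_ne' (left_ne_zero_of_mul hpos.ne')
      have hG0 : 0 < mu S p G :=
        (mu_nonneg hp0 hp1 G).lt_of_ne' (right_ne_zero_of_mul hpos.ne')
      suffices hs : mu S p F * mu S p G = p ^ 4 ∧ (∃ A ∈ F, A.card = 2) ∧ ∃ A ∈ G, A.card = 2 from
        ⟨hs.1, tF hs.2.1, tG hs.2.2⟩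
      rcases (bd m F).eq_empty_or_nonempty with hbF | hbF
      · have hbG : bd m G = ∅ := by
          by_contra hne
          obtain ⟨a, b, -, -, h2, -⟩ := h.symm.bd_single_level hp0 hp hG0 hF0 hsG hsF
            (Finset.nonempty_iff_ne_empty.2 hne)
          exact h2.ne_empty hbF
        have e1 := mu_eq_mu_erase hp1 hF hm (h.up hp0 hp1 hG0) hbF
        have e2 := mu_eq_mu_erase hp1 hG hm (h.symm.up hp0 hp1 hF0) hbG
        have hsub : ∀ {K : Finset (Finset V)}, K ⊆ S.powerset →
            (K.filter fun A => m ∉ A) ⊆ (S.erase m).powerset := by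
          intro K hK A hA
          obtain ⟨h1, h2⟩ := Finset.mem_filter.1 hA
          exact Finset.mem_powerset.2
            (Finset.subset_erase.2 ⟨Finset.mem_powerset.1 (hK h1), h2⟩)
        obtain ⟨i1, i2⟩ := ih' _ _ (hsub hF) (hsub hG) fun A hA B hB =>
          hc A (Finset.mem_filter.1 hA).1 B (Finset.mem_filter.1 hB).1
        rw [← e1, ← e2] at i1 i2
        have heq := le_antisymm i1 hge
        obtain ⟨⟨A, hA, hA2⟩, B, hB, hB2⟩ := i2 heq
        exact ⟨heq, ⟨A, (Finset.mem_filter.1 hA).1, hA2⟩, B, (Finset.mem_filter.1 hB).1, hB2⟩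
      · rcases h.bound_of_bd_nonempty hp0 hp hF0 hG0 hm hsF hsG hbF with h1 | ⟨h1, h2⟩
        · exact absurd hge h1.not_ge
        · exact ⟨le_antisymm h1 hge, h2⟩
    have hle : ∀ F G, F ⊆ S.powerset → G ⊆ S.powerset → Cross F G →
        mu S p F * mu S p G ≤ p ^ 4 := by
      intro F G hF hG hc
      obtain ⟨F', G', h⟩ := exists_isMaxPair S p
      by_contra! hlt
      have h1 := hlt.trans_le (h.max F G hF hG hc)
      exact h1.ne' (key F' G' h h1.le).1
    intro F G hF hG hc
    refine ⟨hle F G hF hG hc, fun heq => ?_⟩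
    exact (key F G ⟨hF, hG, hc, fun F' G' h1 h2 h3 => heq ▸ hle F' G' h1 h2 h3⟩ heq.ge).2

/-! ### Stars and the equality case. -/

theorem mu_star {p : ℝ} (hp1 : p < 1) {S T : Finset V} (hT : T ⊆ S) :
    mu S p (S.powerset.filter fun A => T ⊆ A) = p ^ T.card := by
  induction S using Finset.strongInduction with
  | _ S ih =>
  by_cases hTS : T = S
  · subst hTS
    have : (T.powerset.filter fun A => T ⊆ A) = {T} := by
      ext A
      simp only [Finset.mem_filter, Finset.mem_powerset, Finset.mem_singleton]
      exact ⟨fun h => h.1.antisymm h.2, fun h => h ▸ ⟨subset_rfl, subset_rfl⟩⟩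
    simp [this, mu, wt]
  · obtain ⟨m, hm, hmT⟩ := Finset.exists_of_ssubset (hT.ssubset_of_ne hTS)
    rw [mu_eq_mu_erase hp1 (Finset.filter_subset _ _) hm, Finset.filter_filter,
      ← ih _ (Finset.erase_ssubset hm) (Finset.subset_erase.2 ⟨hT, hmT⟩)]
    · congr 1
      ext A
      simp only [Finset.mem_filter, Finset.mem_powerset, Finset.subset_erase]
      tauto
    · intro A hA B hAB hB
      exact Finset.mem_filter.2
        ⟨Finset.mem_powerset.2 hB, (Finset.mem_filter.1 hA).2.trans hAB⟩
    · refine Finset.filter_eq_empty_iff.2 fun A hA h => h.2 ?_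
      obtain ⟨h1, h2⟩ := Finset.mem_filter.1 hA
      exact Finset.mem_filter.2 ⟨Finset.mem_powerset.2
        ((Finset.erase_subset _ _).trans (Finset.mem_powerset.1 h1)),
        Finset.subset_erase.2 ⟨h2, hmT⟩⟩

theorem eq_of_subset_of_mu_le {p : ℝ} (hp0 : 0 < p) (hp1 : p < 1) {S : Finset V}
    {F G : Finset (Finset V)} (h : F ⊆ G) (hle : mu S p G ≤ mu S p F) : F = G := by
  by_contra hne
  obtain ⟨A, hA, hAF⟩ := Finset.exists_of_ssubset (h.ssubset_of_ne hne)
  have h1 := mu_sdiff (S := S) (p := p) h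
  have h2 := mu_pos_of_nonempty (S := S) hp0 hp1 ⟨A, Finset.mem_sdiff.2 ⟨hA, hAF⟩⟩
  linarith

theorem eq_star_of_mu_mul_mu_eq {p : ℝ} (hp0 : 0 < p) (hp : p < 1 / 3) {S : Finset V}
    {F G : Finset (Finset V)} (hF : F ⊆ S.powerset) (hG : G ⊆ S.powerset) (hc : Cross F G)
    (heq : mu S p F * mu S p G = p ^ 4) :
    ∃ T : Finset V, T.card = 2 ∧ F = S.powerset.filter (fun A => T ⊆ A) ∧
      G = S.powerset.filter (fun A => T ⊆ A) := by
  have hp1 : p < 1 := by linarith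
  have hp2 : 0 < p ^ 2 := by positivity
  obtain ⟨⟨T, hT, hT2⟩, U, hU, hU2⟩ := (mu_mul_mu_le hp0 hp S F G hF hG hc).2 heq
  have hsub : ∀ {F G : Finset (Finset V)}, F ⊆ S.powerset → Cross F G → ∀ U ∈ G, U.card = 2 →
      F ⊆ S.powerset.filter (fun A => U ⊆ A) := by
    intro F G hF hc U hU hU2 A hA
    refine Finset.mem_filter.2 ⟨hF hA, ?_⟩
    have h1 := Finset.eq_of_subset_of_card_le (Finset.inter_subset_right : A ∩ U ⊆ U)
      (hU2 ▸ hc A hA U hU)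
    exact h1 ▸ Finset.inter_subset_left
  -- A 2-set in one family is contained in every member of the other, so `U ⊆ T` and the two
  -- coincide. Both families then lie in one star of measure `p ^ 2`, and the product forces
  -- equality.
  have hFU := hsub hF hc U hU hU2
  have hGT := hsub hG hc.symm T hT hT2
  have hUT : U = T :=
    Finset.eq_of_subset_of_card_le (Finset.mem_filter.1 (hFU hT)).2 (by omega)
  subst hUT
  have hstar := mu_star hp1 (Finset.mem_powerset.1 (hF hT))
  rw [hU2] at hstar
  have h1 := mu_mono (S := S) hp0 hp1 hFU
  have h2 := mu_mono (S := S) hp0 hp1 hGT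
  rw [hstar] at h1 h2
  have h3 := mul_le_mul_of_nonneg_left h2 (mu_nonneg (S := S) hp0 hp1 F)
  have h4 := mul_le_mul_of_nonneg_left h1 (mu_nonneg (S := S) hp0 hp1 G)
  refine ⟨U, hU2, eq_of_subset_of_mu_le (S := S) hp0 hp1 hFU ?_,
    eq_of_subset_of_mu_le (S := S) hp0 hp1 hGT ?_⟩ <;>
  · rw [hstar]
    refine le_of_mul_le_mul_right ?_ hp2
    linarith

end CrossTwo

/-! ### Transfer to `Fin n` and the endpoint `p = 1/3`. -/

theorem biasedMeasure_eq_mu {n : ℕ} (p : ℝ) (F : Finset (Finset (Fin n))) :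
    biasedMeasure p F = CrossTwo.mu Finset.univ p F := by
  simp [biasedMeasure, CrossTwo.mu, CrossTwo.wt]

theorem continuous_biasedMeasure {n : ℕ} (F : Finset (Finset (Fin n))) :
    Continuous fun p : ℝ => biasedMeasure p F := by
  unfold biasedMeasure
  fun_prop

theorem theorem1p5 (n : ℕ) (p : ℝ) (hp0 : 0 < p) (hp : p ≤ 1 / 3)
    (F G : Finset (Finset (Fin n))) (hFG : CrossIntersecting 2 F G) :
    biasedMeasure p F * biasedMeasure p G ≤ p ^ 4 ∧
      (p < 1 / 3 → biasedMeasure p F * biasedMeasure p G = p ^ 4 →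
        ∃ T : Finset (Fin n), T.card = 2 ∧
          F = Finset.univ.filter (fun A : Finset (Fin n) => T ⊆ A) ∧
          G = Finset.univ.filter (fun A : Finset (Fin n) => T ⊆ A)) := by
  have hsub : ∀ K : Finset (Finset (Fin n)), K ⊆ Finset.univ.powerset := fun K A _ => by simp
  have hlt : ∀ q : ℝ, 0 < q → q < 1 / 3 → biasedMeasure q F * biasedMeasure q G ≤ q ^ 4 := by
    intro q hq0 hq
    rw [biasedMeasure_eq_mu, biasedMeasure_eq_mu]
    exact (CrossTwo.mu_mul_mu_le hq0 hq _ F G (hsub F) (hsub G) hFG).1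
  refine ⟨?_, fun hp' heq => ?_⟩
  -- Cross-intersection does not involve `p`, so for fixed families the inequality passes from the
  -- open interval to its closure.
  · have hclosed : IsClosed {q : ℝ | biasedMeasure q F * biasedMeasure q G ≤ q ^ 4} :=
      isClosed_le ((continuous_biasedMeasure F).mul (continuous_biasedMeasure G))
        (continuous_pow 4)
    have hmem := hclosed.closure_subset_iff.2
      (fun q hq => hlt q hq.1 hq.2 : Set.Ioo (0 : ℝ) (1 / 3) ⊆ _)
    rw [closure_Ioo (by norm_num)] at hmem
    exact hmem ⟨hp0.le, hp⟩
  · rw [biasedMeasure_eq_mu, biasedMeasure_eq_mu] at heq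
    obtain ⟨T, hT, h1, h2⟩ :=
      CrossTwo.eq_star_of_mu_mul_mu_eq hp0 hp' (hsub F) (hsub G) hFG heq
    rw [Finset.powerset_univ] at h1 h2
    exact ⟨T, hT, h1, h2⟩
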